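/- Let $A\in\mathbb{R}^{d\times d}$ and $\boldsymbol b\in\mathbb{R}^d$. Let $\mathcal V^c\subseteq\mathbb{C}^d$ be the complex subspace spanned by the generalised eigenvectors of $A$ (vectors $\boldsymbol w$ with $(A-\lambda I)^k\boldsymbol w=0$ for some $k\in\mathbb{N}$) associated with the eigenvalues $\lambda\in\mathbb{C}$ of $A$ with non-zero imaginary part. Let $\boldsymbol v^c\in\mathcal V^c$ be such that $h(t)=\boldsymbol b^{T}\exp(At)\boldsymbol v^c$ is real for all $t\in\mathbb{R}$ (for example $\boldsymbol v^c\in\mathcal V^c\cap\mathbb{R}^d$), and suppose that $h$ is not identically zero. The function $h$ has a unique closed-form expression $h(t)=\sum_{(\lambda,n)} c_{\lambda,n}\,t^{n}e^{\lambda t}$, a finite sum over pairwise distinct pairs $(\lambda,n)\in\mathbb{C}\times\mathbb{N}_0$ with coefficients $c_{\lambda,n}\in\mathbb{C}\setminus\{0\}$. Let $(\rho,m)\in\mathbb{R}\times\mathbb{N}_0$ be dominant for $h$, that is, the lexicographically greatest of the pairs $(\operatorname{Re}\lambda,n)$ for the terms $t^ne^{\lambda t}$ in this expression. Then \[ -\infty<\liminf_{t\to\infty}\frac{h(t)}{e^{\rho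 t}t^{m}}<0 . \] -/

import Mathlib

noncomputable section

/-- `𝒱ᶜ`: the subspace of `ℂ^d` spanned by the generalised eigenvectors (vectors killed by some
power of `A - μ I`) for the eigenvalues `μ` of the real matrix `A` with non-zero imaginary part. -/
def nonrealGenEigenspace {d : ℕ} (A : Matrix (Fin d) (Fin d) ℝ) : Submodule ℂ (Fin d → ℂ) :=
  Submodule.span ℂ {w | ∃ μ : ℂ,
    Module.End.HasEigenvalue (Matrix.toLin' (A.map Complex.ofReal)) μ ∧ μ.im ≠ 0 ∧
      w ∈ Module.End.maxGenEigenspace (Matrix.toLin' (A.map Complex.ofReal)) μ}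

/-- The function `t ↦ bᵀ exp(A t) v`, for real `A`, `b` and complex `v`. -/
def expForm {d : ℕ} (A : Matrix (Fin d) (Fin d) ℝ) (b : Fin d → ℝ) (v : Fin d → ℂ) (t : ℝ) : ℂ :=
  (fun i => (b i : ℂ)) ⬝ᵥ ((NormedSpace.exp (t • A)).map Complex.ofReal).mulVec v

/-- `c` is the (collected) closed-form expression of `f` as an exponential polynomial:
`f t = ∑ c (μ, n) t ^ n exp (μ t)`, a finite sum over pairwise different pairs `(μ, n)`; the terms
occurring in it are those with `c (μ, n) ≠ 0`. -/
def IsClosedForm (f : ℝ → ℂ) (c : ℂ × ℕ →₀ ℂ) : Prop :=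
  ∀ t : ℝ, f t = c.sum fun p a => a * ((t : ℂ) ^ p.2 * Complex.exp (p.1 * t))

/-- `(ρ, m)` is dominant for `f`: it is the lexicographically greatest among the pairs `(Re μ, n)`
for which a term `t ^ n exp (μ t)` occurs in the closed-form expression of `f`. -/
def IsDominant (f : ℝ → ℂ) (ρ : ℝ) (m : ℕ) : Prop :=
  ∃ c : ℂ × ℕ →₀ ℂ, IsClosedForm f c ∧
    IsGreatest {q : ℝ ×ₗ ℕ | ∃ p ∈ c.support, q = toLex (p.1.re, p.2)} (toLex (ρ, m))

end

open Filter Topology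

/-! Dividing `h` by `e^{ρt} t^m` kills every non-dominant term in the limit and leaves a nonzero
trigonometric polynomial `g` with distinct frequencies (`tendsto_closedForm_div_sub_trigPoly`).
Since `g` is bounded, the liminf is not `-∞`. Uniqueness of the closed form (`IsClosedForm.unique`)
and `v ∈ 𝒱ᶜ` make all exponents non-real, so no frequency of `g` is zero and `g` has mean zero. If
the liminf were nonnegative, the quotient would be almost nonnegative and close to `g`, so
eventually `‖g‖ ≤ Re g + ε`. Then `‖g‖` has mean zero, hence so does `‖g‖²` by boundedness, and
Parseval forces every coefficient to vanish (`trigPoly_coeff_eq_zero`). -/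

/-! ### Means of trigonometric polynomials -/

theorem tendsto_mean_exp (T₀ ω : ℝ) :
    Tendsto (fun T : ℝ => (∫ t in T₀..T, Complex.exp (Complex.I * ω * t)) / (T : ℂ)) atTop
      (𝓝 (if ω = 0 then 1 else 0)) := by
  have hinv : Tendsto (fun T : ℝ => ((T⁻¹ : ℝ) : ℂ)) atTop (𝓝 0) := by
    have := (Complex.continuous_ofReal.tendsto 0).comp tendsto_inv_atTop_zero
    rwa [Complex.ofReal_zero] at this
  split_ifs with hω
  · subst hω
    have h1 : Tendsto (fun T : ℝ => 1 - (T₀ : ℂ) * ((T⁻¹ : ℝ) : ℂ)) atTop (𝓝 1) := by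
      simpa using (hinv.const_mul (T₀ : ℂ)).const_sub 1
    refine h1.congr' ?_
    filter_upwards [eventually_gt_atTop 0] with T hT
    have : (T : ℂ) ≠ 0 := by exact_mod_cast hT.ne'
    simp
    field_simp
  · have hc : Complex.I * (ω : ℂ) ≠ 0 := mul_ne_zero Complex.I_ne_zero (by exact_mod_cast hω)
    simp_rw [integral_exp_mul_complex hc, div_eq_mul_inv _ (Complex.ofReal _),
      ← Complex.ofReal_inv]
    refine hinv.zero_mul_isBoundedUnder_le ?_ |>.congr fun T => mul_comm _ _
    refine isBoundedUnder_of ⟨2 / ‖Complex.I * (ω : ℂ)‖, fun T => ?_⟩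
    have hn (x : ℝ) : ‖Complex.exp (Complex.I * ω * x)‖ = 1 := by
      rw [Complex.norm_exp]; simp
    simp only [Function.comp, norm_div]
    gcongr
    refine (norm_sub_le _ _).trans ?_
    rw [hn, hn]; norm_num

/-- The trigonometric polynomial with frequencies `ω i` and coefficients `a i`. -/
noncomputable def trigPoly {ι : Type*} (s : Finset ι) (a : ι → ℂ) (ω : ι → ℝ) (t : ℝ) : ℂ :=
  ∑ i ∈ s, a i * Complex.exp (Complex.I * ω i * t)

theorem continuous_trigPoly {ι : Type*} (s : Finset ι) (a : ι → ℂ) (ω : ι → ℝ) :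
    Continuous (trigPoly s a ω) := by
  unfold trigPoly; fun_prop

theorem norm_trigPoly_le {ι : Type*} (s : Finset ι) (a : ι → ℂ) (ω : ι → ℝ) (t : ℝ) :
    ‖trigPoly s a ω t‖ ≤ ∑ i ∈ s, ‖a i‖ := by
  refine (norm_sum_le _ _).trans (Finset.sum_le_sum fun i _ => ?_)
  rw [norm_mul, Complex.norm_exp]; simp

theorem tendsto_mean_trigPoly {ι : Type*} (s : Finset ι) (a : ι → ℂ) (ω : ι → ℝ) (T₀ : ℝ) :
    Tendsto (fun T : ℝ => (∫ t in T₀..T, trigPoly s a ω t) / (T : ℂ)) atTop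
      (𝓝 (∑ i ∈ s, if ω i = 0 then a i else 0)) := by
  have h1 := tendsto_finsetSum s fun i _ => (tendsto_mean_exp T₀ (ω i)).const_mul (a i)
  simp only [mul_ite, mul_one, mul_zero] at h1
  refine h1.congr fun T => ?_
  unfold trigPoly
  rw [intervalIntegral.integral_finsetSum fun i _ =>
    Continuous.intervalIntegrable (by fun_prop) _ _, Finset.sum_div]
  simp [mul_div_assoc]

theorem norm_sq_trigPoly {ι : Type*} (s : Finset ι) (a : ι → ℂ) (ω : ι → ℝ) (t : ℝ) :
    ((‖trigPoly s a ω t‖ ^ 2 : ℝ) : ℂ) =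
      trigPoly (s ×ˢ s) (fun p => a p.1 * (starRingEnd ℂ) (a p.2)) (fun p => ω p.1 - ω p.2) t := by
  rw [Complex.ofReal_pow, ← Complex.mul_conj', trigPoly, trigPoly, map_sum, Finset.sum_mul_sum,
    Finset.sum_product]
  refine Finset.sum_congr rfl fun i _ => Finset.sum_congr rfl fun j _ => ?_
  rw [map_mul, ← Complex.exp_conj, mul_mul_mul_comm, ← Complex.exp_add]
  congr 2
  simp
  ring

/-- Parseval: in the double sum for the squared norm, injectivity of `ω` leaves only the diagonal
with frequency zero. -/
theorem tendsto_mean_norm_sq_trigPoly {ι : Type*} (s : Finset ι) (a : ι → ℂ) (ω : ι → ℝ)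
    (hω : Set.InjOn ω s) (T₀ : ℝ) :
    Tendsto (fun T : ℝ => (∫ t in T₀..T, ‖trigPoly s a ω t‖ ^ 2) / T) atTop
      (𝓝 (∑ i ∈ s, ‖a i‖ ^ 2)) := by
  classical
  have h1 := tendsto_mean_trigPoly (s ×ˢ s) (fun p => a p.1 * (starRingEnd ℂ) (a p.2))
    (fun p => ω p.1 - ω p.2) T₀
  simp_rw [← norm_sq_trigPoly, intervalIntegral.integral_ofReal] at h1
  have h2 := (Complex.continuous_re.tendsto _).comp h1
  have h3 : (∑ p ∈ s ×ˢ s, if ω p.1 - ω p.2 = 0 then a p.1 * (starRingEnd ℂ) (a p.2) else 0) =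
      ((∑ i ∈ s, ‖a i‖ ^ 2 : ℝ) : ℂ) := by
    rw [Finset.sum_product, Complex.ofReal_sum]
    refine Finset.sum_congr rfl fun i hi => ?_
    rw [Finset.sum_eq_single_of_mem i hi]
    · simp [Complex.mul_conj']
    · intro j hj hji
      rw [if_neg]
      intro h
      exact hji (hω hj hi (sub_eq_zero.1 h).symm)
  rw [h3, Complex.ofReal_re] at h2
  refine h2.congr fun T => ?_
  simp only [Function.comp, ← Complex.ofReal_div, Complex.ofReal_re]

/-- A trigonometric polynomial bounded in norm, up to arbitrarily small errors, by a continuous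
function of mean zero vanishes. -/
theorem trigPoly_coeff_eq_zero {ι : Type*} {s : Finset ι} {a : ι → ℂ} {ω : ι → ℝ}
    (hω : Set.InjOn ω s) {u : ℝ → ℝ} (hu : Continuous u)
    (hmean : ∀ T₀ : ℝ, Tendsto (fun T : ℝ => (∫ t in T₀..T, u t) / T) atTop (𝓝 0))
    (hle : ∀ ε > 0, ∀ᶠ t in atTop, ‖trigPoly s a ω t‖ ≤ u t + ε) :
    ∀ i ∈ s, a i = 0 := by
  set M := ∑ i ∈ s, ‖a i‖ with hM
  have hM0 : 0 ≤ M := Finset.sum_nonneg fun i _ => norm_nonneg _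
  -- From `‖g‖ ≤ M` and `‖g‖ ≤ u + ε` follows `‖g‖² ≤ M (u + ε)`; averaging from the time `T₀` at
  -- which the second bound starts leaves `M ε`.
  have key : ∀ ε > 0, ∑ i ∈ s, ‖a i‖ ^ 2 ≤ M * ε := by
    intro ε hε
    obtain ⟨T₀, hT₀⟩ := eventually_atTop.1 (hle ε hε)
    have h1 : Tendsto (fun T : ℝ => (∫ _t in T₀..T, ε) / T) atTop (𝓝 ε) := by
      have h0 := ((tendsto_inv_atTop_zero (𝕜 := ℝ)).const_mul T₀).const_sub 1 |>.mul_const ε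
      simp only [mul_zero, sub_zero, one_mul] at h0
      refine h0.congr' ?_
      filter_upwards [eventually_gt_atTop 0] with T hT
      simp
      field_simp
    have h2 := ((hmean T₀).add h1).const_mul M
    rw [zero_add] at h2
    refine le_of_tendsto_of_tendsto (tendsto_mean_norm_sq_trigPoly s a ω hω T₀) h2 ?_
    filter_upwards [eventually_gt_atTop 0, eventually_ge_atTop T₀] with T hT hTT
    rw [← add_div, ← mul_div_assoc, ← intervalIntegral.integral_add
      (hu.intervalIntegrable _ _) (continuous_const.intervalIntegrable _ _),
      ← intervalIntegral.integral_const_mul]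
    gcongr
    have hc := continuous_trigPoly s a ω
    refine intervalIntegral.integral_mono_on hTT
      (Continuous.intervalIntegrable (by fun_prop) _ _)
      (Continuous.intervalIntegrable (by fun_prop) _ _) fun t ht => ?_
    rw [sq]
    exact mul_le_mul (norm_trigPoly_le s a ω t) (hT₀ t ht.1) (norm_nonneg _) hM0
  have hle0 : ∑ i ∈ s, ‖a i‖ ^ 2 ≤ 0 := by
    have h3 : Tendsto (fun ε : ℝ => M * ε) (𝓝[>] 0) (𝓝 0) := by
      have : Tendsto (fun ε : ℝ => M * ε) (𝓝 0) (𝓝 (M * 0)) := tendsto_id.const_mul M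
      rw [mul_zero] at this
      exact this.mono_left nhdsWithin_le_nhds
    exact ge_of_tendsto h3 (by filter_upwards [self_mem_nhdsWithin] with ε hε using key ε hε)
  intro i hi
  have := (Finset.sum_eq_zero_iff_of_nonneg fun i _ => sq_nonneg ‖a i‖).1
    (hle0.antisymm (Finset.sum_nonneg fun i _ => sq_nonneg _)) i hi
  simpa using this

/-! ### Dominant terms and uniqueness of the closed form -/

theorem tendsto_monomial_exp_div {p : ℂ × ℕ} {ρ : ℝ} {m : ℕ}
    (h : p.1.re < ρ ∨ p.1.re = ρ ∧ p.2 < m) :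
    Tendsto (fun t : ℝ => (t : ℂ) ^ p.2 * Complex.exp (p.1 * t) /
      ((Real.exp (ρ * t) * t ^ m : ℝ) : ℂ)) atTop (𝓝 0) := by
  rw [tendsto_zero_iff_norm_tendsto_zero]
  have h1 : ∀ᶠ t : ℝ in atTop, t ^ p.2 * Real.exp (-(ρ - p.1.re) * t) / t ^ m =
      ‖(t : ℂ) ^ p.2 * Complex.exp (p.1 * t) / ((Real.exp (ρ * t) * t ^ m : ℝ) : ℂ)‖ := by
    filter_upwards [eventually_gt_atTop 0] with t ht
    rw [norm_div, norm_mul, norm_pow, Complex.norm_exp, Complex.norm_real, Complex.norm_real,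
      Real.norm_of_nonneg ht.le, Real.norm_of_nonneg (by positivity)]
    have : -(ρ - p.1.re) * t = (p.1 * t).re - ρ * t := by simp; ring
    rw [this, Real.exp_sub]
    field_simp
  refine Tendsto.congr' h1 ?_
  rcases h with h | ⟨h, hn⟩
  · have h2 : Tendsto (fun t : ℝ => t ^ p.2 * Real.exp (-(ρ - p.1.re) * t)) atTop (𝓝 0) := by
      simpa using tendsto_rpow_mul_exp_neg_mul_atTop_nhds_zero p.2 (ρ - p.1.re) (sub_pos.2 h)
    refine squeeze_zero' ?_ ?_ h2
    · filter_upwards [eventually_gt_atTop 0] with t ht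
      positivity
    · filter_upwards [eventually_ge_atTop 1] with t ht
      exact div_le_self (by positivity) (one_le_pow₀ ht)
  · simp only [h, sub_self, neg_zero, zero_mul, Real.exp_zero, mul_one]
    exact tendsto_pow_div_pow_atTop_zero hn

/-- The terms of `c` with real part of the exponent `ρ` and degree `m`. -/
noncomputable def topTerms (c : ℂ × ℕ →₀ ℂ) (ρ : ℝ) (m : ℕ) : Finset (ℂ × ℕ) :=
  open Classical in c.support.filter fun p => p.1.re = ρ ∧ p.2 = m

theorem mem_topTerms {c : ℂ × ℕ →₀ ℂ} {ρ : ℝ} {m : ℕ} {p : ℂ × ℕ} :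
    p ∈ topTerms c ρ m ↔ p ∈ c.support ∧ p.1.re = ρ ∧ p.2 = m := by
  simp [topTerms]

theorem injOn_im_topTerms (c : ℂ × ℕ →₀ ℂ) (ρ : ℝ) (m : ℕ) :
    Set.InjOn (fun p : ℂ × ℕ => p.1.im) (topTerms c ρ m) := by
  intro p hp q hq h
  have hp := mem_topTerms.1 (Finset.mem_coe.1 hp)
  have hq := mem_topTerms.1 (Finset.mem_coe.1 hq)
  exact Prod.ext (Complex.ext (hp.2.1.trans hq.2.1.symm) h) (hp.2.2.trans hq.2.2.symm)

theorem tendsto_closedForm_div_sub_trigPoly {f : ℝ → ℂ} {c : ℂ × ℕ →₀ ℂ} (hc : IsClosedForm f c)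
    {ρ : ℝ} {m : ℕ} (hle : ∀ p ∈ c.support, toLex (p.1.re, p.2) ≤ toLex (ρ, m)) :
    Tendsto (fun t : ℝ => f t / ((Real.exp (ρ * t) * t ^ m : ℝ) : ℂ) -
      trigPoly (topTerms c ρ m) c (fun p => p.1.im) t) atTop (𝓝 0) := by
  classical
  have key : ∀ p ∈ c.support, Tendsto (fun t : ℝ =>
      c p * ((t : ℂ) ^ p.2 * Complex.exp (p.1 * t) / ((Real.exp (ρ * t) * t ^ m : ℝ) : ℂ)) -
      if p.1.re = ρ ∧ p.2 = m then c p * Complex.exp (Complex.I * (p.1.im : ℝ) * t) else 0) atTop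
      (𝓝 0) := by
    intro p hp
    split_ifs with h
    · refine tendsto_const_nhds.congr' ?_
      filter_upwards [eventually_gt_atTop 0] with t ht
      have ht' : (t : ℂ) ≠ 0 := by exact_mod_cast ht.ne'
      have h1 : p.1 * t = (ρ * t : ℝ) + Complex.I * (p.1.im : ℝ) * t := by
        conv_lhs => rw [← Complex.re_add_im p.1, h.1]
        push_cast; ring
      rw [h1, Complex.exp_add, h.2, Complex.ofReal_mul (Real.exp _), Complex.ofReal_exp,
        Complex.ofReal_pow]
      have := Complex.exp_ne_zero ((ρ * t : ℝ) : ℂ)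
      field_simp
      simp
    · have h2 : p.1.re < ρ ∨ p.1.re = ρ ∧ p.2 < m := by
        rcases Prod.Lex.toLex_le_toLex.1 (hle p hp) with h3 | ⟨h3, h4⟩
        · exact Or.inl h3
        · exact Or.inr ⟨h3, lt_of_le_of_ne h4 fun h5 => h ⟨h3, h5⟩⟩
      simpa using (tendsto_monomial_exp_div h2).const_mul (c p)
  have h := tendsto_finsetSum _ key
  rw [Finset.sum_const_zero] at h
  refine h.congr fun t => ?_
  rw [Finset.sum_sub_distrib, hc t, Finsupp.sum, Finset.sum_div, trigPoly, topTerms,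
    Finset.sum_filter]
  simp only [mul_div_assoc]

/-- Otherwise the top terms would form a trigonometric polynomial tending to zero, so
`trigPoly_coeff_eq_zero` with `u = 0` kills their coefficients. -/
theorem IsClosedForm.eq_zero {c : ℂ × ℕ →₀ ℂ} (hc : IsClosedForm 0 c) : c = 0 := by
  by_contra h
  obtain ⟨q, hq, hmax⟩ := Finset.exists_max_image c.support
    (fun p => toLex (p.1.re, p.2)) (Finsupp.support_nonempty_iff.2 h)
  have h1 := tendsto_closedForm_div_sub_trigPoly hc hmax
  refine Finsupp.mem_support_iff.1 hq (trigPoly_coeff_eq_zero (u := 0)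
    (injOn_im_topTerms c q.1.re q.2) continuous_zero (by simp) (fun ε hε => ?_) q
    (mem_topTerms.2 ⟨hq, rfl, rfl⟩))
  filter_upwards [(tendsto_zero_iff_norm_tendsto_zero.1 h1).eventually_le_const hε] with t ht
  simpa using ht

theorem IsClosedForm.unique {f : ℝ → ℂ} {c c' : ℂ × ℕ →₀ ℂ} (hc : IsClosedForm f c)
    (hc' : IsClosedForm f c') : c = c' := by
  refine sub_eq_zero.1 (IsClosedForm.eq_zero fun t => ?_)
  rw [Finsupp.sum_sub_index fun p a b => by ring, ← hc t, ← hc' t]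
  simp

/-! ### Closed form of `bᵀ exp(At) v` -/

theorem IsClosedForm.add {f g : ℝ → ℂ} {c c' : ℂ × ℕ →₀ ℂ} (hc : IsClosedForm f c)
    (hc' : IsClosedForm g c') : IsClosedForm (f + g) (c + c') := by
  intro t
  classical
  rw [Finsupp.sum_add_index (by simp) (by intros; ring), ← hc t, ← hc' t]
  simp

theorem IsClosedForm.smul {f : ℝ → ℂ} {c : ℂ × ℕ →₀ ℂ} (hc : IsClosedForm f c) (z : ℂ) :
    IsClosedForm (z • f) (z • c) := by
  intro t
  rw [Finsupp.sum_smul_index (by simp), Pi.smul_apply, hc t, Finsupp.smul_sum]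
  simp [mul_assoc]

theorem IsClosedForm.sum_single (k : ℕ) (μ : ℂ) (a : ℕ → ℂ) :
    IsClosedForm (fun t => Complex.exp (μ * t) * ∑ n ∈ Finset.range k, a n * (t : ℂ) ^ n)
      (∑ n ∈ Finset.range k, Finsupp.single (μ, n) (a n)) := by
  intro t
  rw [← Finsupp.sum_finsetSum_index (by simp) (by intros; ring)]
  dsimp only
  rw [Finset.mul_sum]
  refine Finset.sum_congr rfl fun n _ => ?_
  rw [Finsupp.sum_single_index (by simp)]
  ring

attribute [local instance] Matrix.linftyOpNormedRing Matrix.linftyOpNormedAlgebra in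
theorem exp_smul_mulVec_eq_sum {d : ℕ} (N : Matrix (Fin d) (Fin d) ℂ) (w : Fin d → ℂ) (k : ℕ)
    (hk : (N ^ k).mulVec w = 0) (t : ℂ) :
    (NormedSpace.exp (t • N)).mulVec w =
      ∑ n ∈ Finset.range k, ((n.factorial : ℂ)⁻¹ * t ^ n) • (N ^ n).mulVec w := by
  have h1 := NormedSpace.exp_series_hasSum_exp' (𝕂 := ℂ) (t • N)
  have hcont : Continuous fun M : Matrix (Fin d) (Fin d) ℂ => M.mulVec w := by fun_prop
  have h2 := h1.map (Matrix.mulVec.addMonoidHomLeft w) hcont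
  refine h2.unique ?_
  have h3 : ∀ n, (⇑(Matrix.mulVec.addMonoidHomLeft w) ∘
      fun n : ℕ => (n.factorial : ℂ)⁻¹ • (t • N) ^ n) n =
      ((n.factorial : ℂ)⁻¹ * t ^ n) • (N ^ n).mulVec w := by
    intro n
    simp [Matrix.mulVec.addMonoidHomLeft, smul_pow, Matrix.smul_mulVec, smul_smul]
  rw [funext h3]
  refine hasSum_sum_of_ne_finset_zero fun n hn => ?_
  obtain ⟨j, rfl⟩ := Nat.exists_eq_add_of_le (not_lt.1 (Finset.mem_range.not.1 hn))
  rw [add_comm, pow_add N, ← Matrix.mulVec_mulVec, hk, Matrix.mulVec_zero, smul_zero]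

attribute [local instance] Matrix.linftyOpNormedRing Matrix.linftyOpNormedAlgebra in
theorem map_ofReal_exp {d : ℕ} (A : Matrix (Fin d) (Fin d) ℝ) :
    (NormedSpace.exp A).map Complex.ofReal = NormedSpace.exp (A.map Complex.ofReal) := by
  have hcont : Continuous fun M : Matrix (Fin d) (Fin d) ℝ => M.map Complex.ofReal := by
    fun_prop
  exact NormedSpace.map_exp (Complex.ofRealHom.mapMatrix (m := Fin d)) hcont A

theorem exp_smul_eq_smul_exp {d : ℕ} (B : Matrix (Fin d) (Fin d) ℂ) (μ t : ℂ) :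
    NormedSpace.exp (t • B) =
      Complex.exp (μ * t) • NormedSpace.exp (t • (B - Matrix.scalar (Fin d) μ)) := by
  have h1 : t • B = Matrix.scalar (Fin d) (μ * t) + t • (B - Matrix.scalar (Fin d) μ) := by
    ext i j
    by_cases hij : i = j <;> simp [hij, Matrix.scalar_apply] <;> ring
  have hcomm : Commute (Matrix.scalar (Fin d) (μ * t)) (t • (B - Matrix.scalar (Fin d) μ)) :=
    Matrix.scalar_commute _ (fun _ => Commute.all _ _) _
  rw [h1, Matrix.exp_add_of_commute _ _ hcomm, Matrix.scalar_apply, Matrix.exp_diagonal]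
  have h2 : NormedSpace.exp (fun _ : Fin d => μ * t) = fun _ => Complex.exp (μ * t) := by
    ext i
    rw [Pi.coe_exp, Complex.exp_eq_exp_ℂ]
  rw [h2, Matrix.smul_eq_diagonal_mul _ (Complex.exp _)]

/-- Factor `exp(tA) = e^{μt} exp(t(A - μI))`; on `w` the second series stops at a power of `A - μI`
that kills `w`. -/
theorem exists_closedForm_of_mem_maxGenEigenspace {d : ℕ} (A : Matrix (Fin d) (Fin d) ℝ)
    (b : Fin d → ℝ) (w : Fin d → ℂ) (μ : ℂ)
    (hw : w ∈ Module.End.maxGenEigenspace (Matrix.toLin' (A.map Complex.ofReal)) μ) :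
    ∃ c : ℂ × ℕ →₀ ℂ, IsClosedForm (expForm A b w) c ∧ ∀ p ∈ c.support, p.1 = μ := by
  classical
  obtain ⟨k, hk⟩ := Module.End.mem_maxGenEigenspace _ _ _ |>.1 hw
  set N := A.map Complex.ofReal - Matrix.scalar (Fin d) μ with hN
  have hN' : Matrix.toLin' (A.map Complex.ofReal) - μ • (1 : Module.End ℂ (Fin d → ℂ)) =
      Matrix.toLin' N := by
    rw [hN, map_sub]
    congr 1
    ext i j
    simp [Matrix.scalar_apply, Pi.single_apply]
  rw [hN', ← Matrix.toLin'_pow, Matrix.toLin'_apply] at hk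
  refine ⟨∑ n ∈ Finset.range k, Finsupp.single (μ, n) ((n.factorial : ℂ)⁻¹ *
    ((fun i => (b i : ℂ)) ⬝ᵥ (N ^ n).mulVec w)), ?_, fun p hp => ?_⟩
  · convert IsClosedForm.sum_single k μ _ using 1
    ext t
    have h1 : (t • A).map Complex.ofReal = (t : ℂ) • A.map Complex.ofReal := by
      ext i j; simp
    rw [expForm, map_ofReal_exp, h1, exp_smul_eq_smul_exp _ μ, Matrix.smul_mulVec,
      exp_smul_mulVec_eq_sum _ _ k hk, dotProduct_smul, dotProduct_sum, smul_eq_mul]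
    congr 1
    refine Finset.sum_congr rfl fun n _ => ?_
    rw [dotProduct_smul, smul_eq_mul]
    ring
  · obtain ⟨n, _, hn⟩ := Finset.mem_biUnion.1 (Finsupp.support_finsetSum hp)
    rw [Finset.mem_singleton.1 (Finsupp.support_single_subset hn)]

theorem exists_closedForm_of_mem_nonrealGenEigenspace {d : ℕ} (A : Matrix (Fin d) (Fin d) ℝ)
    (b : Fin d → ℝ) {v : Fin d → ℂ} (hv : v ∈ nonrealGenEigenspace A) :
    ∃ c : ℂ × ℕ →₀ ℂ, IsClosedForm (expForm A b v) c ∧ ∀ p ∈ c.support, p.1.im ≠ 0 := by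
  classical
  induction hv using Submodule.span_induction with
  | mem w hw =>
    obtain ⟨μ, _, hμ, hw⟩ := hw
    obtain ⟨c, hc, hcμ⟩ := exists_closedForm_of_mem_maxGenEigenspace A b w μ hw
    exact ⟨c, hc, fun p hp => hcμ p hp ▸ hμ⟩
  | zero => exact ⟨0, fun t => by simp [expForm], by simp⟩
  | add x y _ _ hx hy =>
    obtain ⟨c, hc, hcs⟩ := hx
    obtain ⟨c', hc', hcs'⟩ := hy
    refine ⟨c + c', ?_, fun p hp => ?_⟩
    · convert hc.add hc' using 1
      ext t
      simp [expForm, Matrix.mulVec_add, dotProduct_add]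
    · exact (Finset.mem_union.1 (Finsupp.support_add hp)).elim (hcs p) (hcs' p)
  | smul z x _ hx =>
    obtain ⟨c, hc, hcs⟩ := hx
    refine ⟨z • c, ?_, fun p hp => hcs p (Finsupp.support_smul hp)⟩
    convert hc.smul z using 1
    ext t
    simp [expForm, Matrix.mulVec_smul, dotProduct_smul]

/-! ### The sign of the liminf -/

theorem mainTheorem5 {d : ℕ} (A : Matrix (Fin d) (Fin d) ℝ) (b : Fin d → ℝ)
    (v : Fin d → ℂ) (hv : v ∈ nonrealGenEigenspace A)
    (h : ℝ → ℝ) (hh : ∀ t : ℝ, (h t : ℂ) = expForm A b v t)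
    (ρ : ℝ) (m : ℕ) (hdom : IsDominant (expForm A b v) ρ m)
    (hne : ∃ t : ℝ, h t ≠ 0) :
    (⊥ : EReal) < Filter.liminf
        (fun t : ℝ => ((h t / (Real.exp (ρ * t) * t ^ m) : ℝ) : EReal)) Filter.atTop ∧
      Filter.liminf
        (fun t : ℝ => ((h t / (Real.exp (ρ * t) * t ^ m) : ℝ) : EReal)) Filter.atTop < 0 := by
  obtain ⟨c, hc, ⟨q, hq, hqe⟩, hmax⟩ := hdom
  obtain ⟨c', hc', him⟩ := exists_closedForm_of_mem_nonrealGenEigenspace A b hv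
  -- The expression witnessing dominance is thus the one with non-real exponents.
  obtain rfl := hc.unique hc'
  obtain ⟨rfl, rfl⟩ := Prod.ext_iff.1 (toLex.injective hqe)
  have hlim := tendsto_closedForm_div_sub_trigPoly hc
    fun p hp => hmax ⟨p, hp, rfl⟩
  set g := trigPoly (topTerms c q.1.re q.2) c (fun p => p.1.im) with hg
  set F : ℝ → ℝ := fun t => h t / (Real.exp (q.1.re * t) * t ^ q.2) with hF
  have hlim' : Tendsto (fun t => ‖(F t : ℂ) - g t‖) atTop (𝓝 0) := by
    refine (tendsto_zero_iff_norm_tendsto_zero.1 hlim).congr fun t => ?_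
    rw [hF, ← hh t, ← Complex.ofReal_div]
  constructor
  · refine (EReal.bot_lt_coe (-(∑ i ∈ topTerms c q.1.re q.2, ‖c i‖) - 1)).trans_le
      (le_liminf_of_le (by isBoundedDefault) ?_)
    filter_upwards [hlim'.eventually_le_const one_pos] with t ht
    rw [EReal.coe_le_coe_iff]
    have h1 := norm_trigPoly_le (topTerms c q.1.re q.2) c (fun p => p.1.im) t
    have h2 : ‖(F t : ℂ)‖ ≤ ‖(F t : ℂ) - g t‖ + ‖g t‖ := by
      simpa using norm_add_le ((F t : ℂ) - g t) (g t)
    rw [Complex.norm_real, Real.norm_eq_abs] at h2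
    have := neg_abs_le (F t)
    linarith
  · by_contra hcon
    rw [not_lt] at hcon
    refine Finsupp.mem_support_iff.1 hq (trigPoly_coeff_eq_zero (u := fun t => (g t).re)
      (injOn_im_topTerms c q.1.re q.2)
      (Complex.continuous_re.comp (continuous_trigPoly _ _ _)) (fun T₀ => ?_) (fun ε hε => ?_) q
      (mem_topTerms.2 ⟨hq, rfl, rfl⟩))
    · have h1 := (Complex.continuous_re.tendsto _).comp
        (tendsto_mean_trigPoly (topTerms c q.1.re q.2) c (fun p => p.1.im) T₀)
      rw [Finset.sum_eq_zero fun p hp => if_neg (him p (mem_topTerms.1 hp).1)] at h1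
      refine h1.congr fun T => ?_
      have h2 : (∫ t in T₀..T, (g t).re) = (∫ t in T₀..T, g t).re :=
        Complex.reCLM.intervalIntegral_comp_comm
          ((continuous_trigPoly _ _ _).intervalIntegrable _ _)
      rw [h2]
      simp [hg, Complex.div_ofReal_re]
    · have hε4 : 0 < ε / 4 := by positivity
      have hev := eventually_lt_of_lt_liminf
        (lt_of_lt_of_le (EReal.coe_lt_coe_iff.2 (neg_lt_zero.2 hε4)) hcon)
        (by isBoundedDefault)
      filter_upwards [hev, hlim'.eventually_le_const hε4] with t ht1 ht2
      rw [EReal.coe_lt_coe_iff] at ht1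
      have h1 : ‖g t‖ ≤ |F t| + ‖(F t : ℂ) - g t‖ := by
        have := norm_sub_le (F t : ℂ) ((F t : ℂ) - g t)
        rwa [sub_sub_cancel, Complex.norm_real, Real.norm_eq_abs] at this
      have h2 : F t - (g t).re ≤ ‖(F t : ℂ) - g t‖ := by
        simpa using Complex.re_le_norm ((F t : ℂ) - g t)
      -- Uses `F t > -ε/4`. The budget `ε` is spent as `ε/2` here and `ε/4` in each of `h1` and
      -- `h2`.
      have h3 : |F t| ≤ F t + 2 * (ε / 4) := abs_le.2 ⟨by linarith, by linarith⟩
      change ‖g t‖ ≤ (g t).re + ε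
      linarith
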